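/- Let $H$ be a complex Hilbert space and let $\mathcal{N}$ be a nest of projections in $B(H)$, i.e. a set of orthogonal projections on $H$ that is totally ordered (by $\le$, equivalently by inclusion of ranges) and contains $0$ and $I$ (the set $\mathcal{N}$ need not be closed in the strong operator topology, and $H$ need not be separable). Let $\mathrm{Alg}\,\mathcal{N}$ be the algebra of all operators in $B(H)$ that leave the range of every $N\in\mathcal{N}$ invariant. Fix $B,C\in B(H)$. Then the following conditions are equivalent: (1) There exists $X\in \mathrm{Alg}\,\mathcal{N}$ with $\|X\|\le 1$ and $BX=C$. (2) For every projection $N\in\mathcal{N}$, $CNC^*\le BNB^*$. -/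

import Mathlib

/-- A nest of projections on the complex Hilbert space `H`: a set of orthogonal projections which
contains `0` and the identity and is totally ordered (by the Loewner order, which for projections is
inclusion of ranges). Closedness in the strong operator topology is not required. -/
structure IsNest {H : Type*} [NormedAddCommGroup H] [InnerProductSpace ℂ H] [CompleteSpace H]
    (𝒩 : Set (H →L[ℂ] H)) : Prop where
  isStarProjection : ∀ N ∈ 𝒩, IsStarProjection N
  isChain : IsChain (· ≤ ·) 𝒩
  zero_mem : 0 ∈ 𝒩
  one_mem : 1 ∈ 𝒩

/-- `Alg 𝒩`: the algebra of all bounded operators on `H` that leave the range of every member of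
`𝒩` invariant. -/
def nestAlgebra {H : Type*} [NormedAddCommGroup H] [InnerProductSpace ℂ H]
    (𝒩 : Set (H →L[ℂ] H)) : Subalgebra ℂ (H →L[ℂ] H) where
  carrier := {T | ∀ N ∈ 𝒩, ∀ x ∈ N.range, T x ∈ N.range}
  mul_mem' := fun hS hT N hN x hx => hS N hN _ (hT N hN x hx)
  add_mem' := fun hS hT N hN x hx => N.range.add_mem (hS N hN x hx) (hT N hN x hx)
  algebraMap_mem' := fun c N _ x hx => by
    simpa [Algebra.algebraMap_eq_smul_one] using N.range.smul_mem c hx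

/-! With `Y = X*`, `A = B*`, `D = C*`, the task is to find a contraction with `Y A = D` and `N Y = N
Y N` for all `N` in the nest, and condition (2) reads `‖N D x‖ ≤ ‖N A x‖`. One direction is
immediate from `N D = N Y N A`. For finitely many projections, `Y` is built block row by block row
up the chain: the room that a partial solution leaves for a new row is measured by its defect
operator, (2) is exactly the domination Douglas' lemma needs, and lower rows stay untouched
(`exists_extend_contraction`). All constraints are weakly closed, so weak compactness of the unit
ball handles arbitrary nests. -/

section NestInterpolation

variable {H : Type*} [NormedAddCommGroup H] [InnerProductSpace ℂ H] [CompleteSpace H]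

/-- Douglas' factorization lemma: a norm-dominated operator factors through the dominating one by
a contraction. -/
theorem exists_contraction_mul_eq {S D : H →L[ℂ] H} (h : ∀ x, ‖D x‖ ≤ ‖S x‖) :
    ∃ Z : H →L[ℂ] H, (∀ x, ‖Z x‖ ≤ ‖x‖) ∧ ∀ x, Z (S x) = D x := by
  let K : Submodule ℂ H := S.range.topologicalClosure
  have hmem : ∀ x, S.toLinearMap x ∈ K := fun x =>
    S.range.le_topologicalClosure ⟨x, rfl⟩
  let e : H →ₗ[ℂ] K := S.toLinearMap.codRestrict K hmem
  have he : DenseRange e := by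
    intro y
    rw [Topology.IsInducing.subtypeVal.closure_eq_preimage_closure_image]
    have : (Subtype.val '' Set.range e : Set H) = (S.range : Set H) := by
      ext z
      simp [e]
    exact Set.mem_preimage.mpr (this ▸ y.2)
  have hn : ∀ x, ‖D.toLinearMap x‖ ≤ 1 * ‖e x‖ := fun x => by
    simpa [e] using h x
  have : CompleteSpace K := S.range.isClosed_topologicalClosure.completeSpace_coe
  -- `S x ↦ D x` extends by continuity to the closure of the range, and by zero on its complement.
  refine ⟨(D.toLinearMap.extendOfNorm e).comp K.orthogonalProjectionOnto, fun x => ?_, fun x => ?_⟩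
  · calc _ ≤ 1 * ‖K.orthogonalProjectionOnto x‖ :=
          LinearMap.norm_extendOfNorm_apply_le he 1 hn _
      _ ≤ ‖x‖ := by
          rw [one_mul]; exact K.norm_orthogonalProjectionOnto_apply_le x
  · have : K.orthogonalProjectionOnto (S x) = e x :=
      K.orthogonalProjectionOnto_mem_subspace_eq_self (e x)
    rw [ContinuousLinearMap.comp_apply, this]
    exact LinearMap.extendOfNorm_eq he ⟨1, hn⟩ x

/-- The defect operator of a contraction. -/
theorem exists_norm_sq_defect {Y : H →L[ℂ] H} (hY : ‖Y‖ ≤ 1) :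
    ∃ W : H →L[ℂ] H, ∀ x, ‖W x‖ ^ 2 = ‖x‖ ^ 2 - ‖Y x‖ ^ 2 := by
  have h0 : 0 ≤ 1 - star Y * Y := by
    rw [sub_nonneg]
    refine (CStarAlgebra.star_mul_le_algebraMap_norm_sq).trans ?_
    rw [← map_one (algebraMap ℝ (H →L[ℂ] H))]
    exact algebraMap_mono _ (pow_le_one₀ (norm_nonneg _) hY)
  obtain ⟨W, hW⟩ := CStarAlgebra.nonneg_iff_eq_star_mul_self.mp h0
  have key : ∀ (T : H →L[ℂ] H) (x : H), inner ℂ ((star T * T) x) x = ((‖T x‖ ^ 2 : ℝ) : ℂ) := by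
    intro T x
    rw [ContinuousLinearMap.star_eq_adjoint, mul_apply_eq_comp,
      ContinuousLinearMap.adjoint_inner_left, inner_self_eq_norm_sq_to_K]
    simp
  refine ⟨W, fun x => ?_⟩
  have h1 := key W x
  rw [← hW, sub_apply, inner_sub_left, key Y x, one_apply_eq_self,
    inner_self_eq_norm_sq_to_K] at h1
  have h2 : ((‖x‖ ^ 2 - ‖Y x‖ ^ 2 : ℝ) : ℂ) = ((‖W x‖ ^ 2 : ℝ) : ℂ) := by
    rw [← h1]
    simp
  exact (Complex.ofReal_injective h2).symm

theorem IsStarProjection.inner_apply_left {N : H →L[ℂ] H} (hN : IsStarProjection N) (x y : H) :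
    inner ℂ (N x) y = inner ℂ x (N y) := by
  rw [← ContinuousLinearMap.adjoint_inner_left, ← ContinuousLinearMap.star_eq_adjoint,
    hN.isSelfAdjoint.star_eq]

theorem IsStarProjection.apply_apply {N : H →L[ℂ] H} (hN : IsStarProjection N) (x : H) :
    N (N x) = N x :=
  congr($(hN.isIdempotentElem.eq) x)

/-- Pythagoras for an orthogonal projection. -/
theorem IsStarProjection.norm_sq_add {N : H →L[ℂ] H} (hN : IsStarProjection N) {u v : H}
    (hu : N u = u) (hv : N v = 0) : ‖u + v‖ ^ 2 = ‖u‖ ^ 2 + ‖v‖ ^ 2 := by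
  have : inner ℂ u v = 0 := by rw [← hu, hN.inner_apply_left, hv, inner_zero_right]
  have := norm_add_sq_eq_norm_sq_add_norm_sq_of_inner_eq_zero u v this
  simpa only [sq] using this

theorem IsStarProjection.norm_apply_le {N : H →L[ℂ] H} (hN : IsStarProjection N) (x : H) :
    ‖N x‖ ≤ ‖x‖ := by
  simpa using N.le_of_opNorm_le hN.norm_le x

/-- One step of the row-by-row construction: a contraction solving the interpolation problem on the
range of `M` extends to one solving it on the range of a larger projection `T`. -/
theorem exists_extend_contraction {M T A D Y : H →L[ℂ] H} (hM : IsStarProjection M)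
    (hT : IsStarProjection T) (hMT : M ≤ T) (hle : ∀ x, ‖T (D x)‖ ≤ ‖T (A x)‖)
    (hY : ‖Y‖ ≤ 1) (hMY : M * Y = Y) (hYM : Y * M = Y) (hYA : Y * A = M * D) :
    ∃ Y' : H →L[ℂ] H, ‖Y'‖ ≤ 1 ∧ T * Y' = Y' ∧ Y' * T = Y' ∧ Y' * A = T * D ∧ M * Y' = Y := by
  have hMT1 : M * T = M := (hM.le_iff_mul_eq_left hT).mp hMT
  have hMT2 : T * M = M := (hM.le_iff_mul_eq_right hT).mp hMT
  have hYT : Y * T = Y := by rw [← hYM, mul_assoc, hMT1]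
  have hTY : T * Y = Y := by rw [← hMY, ← mul_assoc, hMT2]
  have hMM := hM.isIdempotentElem.eq
  have hTT := hT.isIdempotentElem.eq
  have hE : IsStarProjection (T - M) := hM.sub_of_mul_eq_left hT hMT1
  have hME : M * (T - M) = 0 := by rw [mul_sub, hMT1, hMM, sub_self]
  have hTE : T * (T - M) = T - M := by rw [mul_sub, hMT2, hTT]
  obtain ⟨W, hW⟩ := exists_norm_sq_defect hY
  -- Since `Y T A = M D`, Pythagoras gives `‖(T - M) D x‖² = ‖T D x‖² - ‖Y T A x‖² ≤ ‖T A x‖² - ‖Y T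
  -- A x‖² = ‖W T A x‖²`.
  have hdom : ∀ x, ‖((T - M) * D) x‖ ≤ ‖(W * T * A) x‖ := by
    intro x
    refine le_of_sq_le_sq ?_ (norm_nonneg _)
    have h1 : ‖T (D x)‖ ^ 2 = ‖M (D x)‖ ^ 2 + ‖(T - M) (D x)‖ ^ 2 := by
      have hv : M ((T - M) (D x)) = 0 := congr($hME (D x))
      rw [← hM.norm_sq_add (hM.apply_apply _) hv]
      simp
    have h2 : Y (T (A x)) = M (D x) := by
      have : Y * T * A = M * D := by rw [hYT, hYA]
      exact congr($this x)
    have h3 := hW (T (A x))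
    have h4 : ‖T (D x)‖ ^ 2 ≤ ‖T (A x)‖ ^ 2 := by gcongr; exact hle x
    rw [h2] at h3
    change ‖(T - M) (D x)‖ ^ 2 ≤ ‖W (T (A x))‖ ^ 2
    linarith
  obtain ⟨Z, hZ, hZW⟩ := exists_contraction_mul_eq hdom
  have hZW' : Z * (W * T * A) = (T - M) * D := ContinuousLinearMap.ext hZW
  -- The added row has range orthogonal to that of `M`, and its squared norm at `x` is at most `‖T
  -- x‖² - ‖Y x‖²`.
  refine ⟨Y + (T - M) * (Z * (W * T)), ?_, ?_, ?_, ?_, ?_⟩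
  · refine ContinuousLinearMap.opNorm_le_bound _ zero_le_one fun x => ?_
    rw [one_mul]
    refine le_of_sq_le_sq ?_ (norm_nonneg _)
    have h1 : Y (T x) = Y x := congr($hYT x)
    have h2 := hW (T x)
    rw [h1] at h2
    have h3 : ‖(T - M) (Z (W (T x)))‖ ^ 2 ≤ ‖W (T x)‖ ^ 2 := by
      gcongr
      exact (hE.norm_apply_le _).trans (hZ _)
    have h4 : ‖T x‖ ^ 2 ≤ ‖x‖ ^ 2 := by
      gcongr
      exact hT.norm_apply_le x
    change ‖Y x + (T - M) (Z (W (T x)))‖ ^ 2 ≤ ‖x‖ ^ 2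
    have hu : M (Y x) = Y x := congr($hMY x)
    have hv : M ((T - M) (Z (W (T x)))) = 0 := congr($hME (Z (W (T x))))
    rw [hM.norm_sq_add hu hv]
    linarith
  · rw [mul_add, hTY, ← mul_assoc, hTE]
  · rw [add_mul, hYT, mul_assoc, mul_assoc Z, mul_assoc W, hTT]
  · rw [add_mul, hYA, mul_assoc, mul_assoc Z, hZW', ← mul_assoc, hE.isIdempotentElem.eq, sub_mul]
    abel
  · rw [mul_add, hMY, ← mul_assoc, hME, zero_mul, add_zero]

/-- The interpolation problem for finitely many members of a nest, on the range of a projection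
`T` dominating all of them. -/
theorem IsNest.exists_contraction_finset {𝒩 : Set (H →L[ℂ] H)} (h𝒩 : IsNest 𝒩)
    {A D : H →L[ℂ] H} (hle : ∀ N ∈ 𝒩, ∀ x, ‖N (D x)‖ ≤ ‖N (A x)‖) (F : Finset (H →L[ℂ] H)) :
    ↑F ⊆ 𝒩 → ∀ T ∈ 𝒩, (∀ M ∈ F, M ≤ T) →
      ∃ Y : H →L[ℂ] H, ‖Y‖ ≤ 1 ∧ T * Y = Y ∧ Y * T = Y ∧ Y * A = T * D ∧
        ∀ M ∈ F, M * Y = M * Y * M := by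
  classical
  induction F using Finset.strongInduction with
  | H F ih =>
  intro hF T hT hFT
  rcases F.eq_empty_or_nonempty with rfl | hne
  · obtain ⟨Y, h1, h2, h3, h4, -⟩ := exists_extend_contraction (Y := 0)
      (h𝒩.isStarProjection 0 h𝒩.zero_mem) (h𝒩.isStarProjection T hT)
      (h𝒩.isStarProjection T hT).nonneg (hle T hT) (by simp) (by simp) (by simp) (by simp)
    exact ⟨Y, h1, h2, h3, h4, by simp⟩
  · obtain ⟨M, hMF, hMmax⟩ := F.exists_maximal hne
    have hM : M ∈ 𝒩 := hF hMF
    have hFM : ∀ L ∈ F, L ≤ M := fun L hL =>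
      (h𝒩.isChain.total (hF hL) hM).elim id fun h => hMmax hL h
    have hpM := h𝒩.isStarProjection M hM
    -- The largest element of `F` becomes the new top projection; `Y = Y M` then yields its own
    -- constraint.
    obtain ⟨Y, h1, h2, h3, h4, h5⟩ := ih (F.erase M) (Finset.erase_ssubset hMF)
      (fun L hL => hF (Finset.mem_of_mem_erase hL)) M hM
      (fun L hL => hFM L (Finset.mem_of_mem_erase hL))
    obtain ⟨Y', k1, k2, k3, k4, k5⟩ := exists_extend_contraction hpM
      (h𝒩.isStarProjection T hT) (hFT M hMF) (hle T hT) h1 h2 h3 h4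
    refine ⟨Y', k1, k2, k3, k4, fun L hL => ?_⟩
    have hLM : L * M = L :=
      ((h𝒩.isStarProjection L (hF hL)).le_iff_mul_eq_left hpM).mp (hFM L hL)
    have hLY : L * Y' = L * Y := by rw [← hLM, mul_assoc, k5, hLM]
    rw [hLY]
    by_cases h : L = M
    · rw [h, mul_assoc, h3]
    · exact h5 L (Finset.mem_erase.mpr ⟨h, hL⟩)

/-- Compactness of the unit ball of `B(H)` in the weak operator topology. -/
theorem exists_tendsto_inner_of_norm_le_one {ι : Type*} (l : Ultrafilter ι)
    (Y : ι → H →L[ℂ] H) (hY : ∀ i, ‖Y i‖ ≤ 1) :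
    ∃ Z : H →L[ℂ] H, ‖Z‖ ≤ 1 ∧
      ∀ x y, Filter.Tendsto (fun i => inner ℂ (Y i x) y) l (nhds (inner ℂ (Z x) y)) := by
  have hb : ∀ x y i, inner ℂ (Y i x) y ∈ Metric.closedBall (0 : ℂ) (‖x‖ * ‖y‖) := by
    intro x y i
    rw [mem_closedBall_zero_iff]
    refine (norm_inner_le_norm _ _).trans ?_
    gcongr
    simpa using (Y i).le_of_opNorm_le (hY i) x
  have hex : ∀ x y, ∃ c ∈ Metric.closedBall (0 : ℂ) (‖x‖ * ‖y‖),
      Filter.Tendsto (fun i => inner ℂ (Y i x) y) l (nhds c) := fun x y =>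
    (isCompact_closedBall (0 : ℂ) (‖x‖ * ‖y‖)).ultrafilter_le_nhds
      (l.map fun i => inner ℂ (Y i x) y)
      (Filter.le_principal_iff.mpr (Filter.mem_map.mpr (Filter.Eventually.of_forall (hb x y))))
  choose b hbn hbt using hex
  -- Sesquilinearity passes to the pointwise limit by uniqueness of limits.
  let f : H →ₗ⋆[ℂ] H →ₗ[ℂ] ℂ := LinearMap.mk₂'ₛₗ (starRingEnd ℂ) (RingHom.id ℂ) b
    (fun x x' y => tendsto_nhds_unique (hbt (x + x') y) <| by
      simpa [inner_add_left] using (hbt x y).add (hbt x' y))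
    (fun c x y => tendsto_nhds_unique (hbt (c • x) y) <| by
      simpa [inner_smul_left, mul_comm] using (hbt x y).const_mul (starRingEnd ℂ c))
    (fun x y y' => tendsto_nhds_unique (hbt x (y + y')) <| by
      simpa [inner_add_right] using (hbt x y).add (hbt x y'))
    (fun c x y => tendsto_nhds_unique (hbt x (c • y)) <| by
      simpa [inner_smul_right] using (hbt x y).const_mul c)
  have hf : ∀ x y, ‖f x y‖ ≤ 1 * ‖x‖ * ‖y‖ := fun x y => by
    simpa [f] using hbn x y
  let Z := InnerProductSpace.continuousLinearMapOfBilin (f.mkContinuous₂ 1 hf)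
  have hZ : ∀ x y, inner ℂ (Z x) y = b x y := fun x y => by simp [Z, f]
  refine ⟨Z, ?_, fun x y => by rw [hZ]; exact hbt x y⟩
  refine ContinuousLinearMap.opNorm_le_of_re_inner_le zero_le_one fun x y hx hy => ?_
  rw [hZ]
  simpa [f, hx, hy] using (Complex.re_le_norm _).trans (hf x y)

theorem mul_mul_star_le_iff (N A D : H →L[ℂ] H) (hN : IsStarProjection N) :
    D * N * star D ≤ A * N * star A ↔ ∀ x, ‖N (star D x)‖ ≤ ‖N (star A x)‖ := by
  have key : ∀ (T : H →L[ℂ] H) (x : H),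
      inner ℂ ((T * N * star T) x) x = ((‖N (star T x)‖ ^ 2 : ℝ) : ℂ) := by
    intro T x
    rw [mul_apply_eq_comp, mul_apply_eq_comp,
      ← ContinuousLinearMap.adjoint_inner_right, ← ContinuousLinearMap.star_eq_adjoint,
      ← hN.apply_apply (star T x), hN.inner_apply_left, inner_self_eq_norm_sq_to_K, hN.apply_apply]
    simp
  rw [ContinuousLinearMap.le_def, ContinuousLinearMap.isPositive_iff_complex]
  refine forall_congr' fun x => ?_
  rw [sub_apply, inner_sub_left, key, key, ← Complex.ofReal_sub,
    RCLike.re_eq_complex_re, Complex.ofReal_re, sub_nonneg,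
    sq_le_sq₀ (norm_nonneg _) (norm_nonneg _)]
  simp

/-- Adjoint of `X N = N X N`. -/
theorem mem_nestAlgebra_iff {𝒩 : Set (H →L[ℂ] H)} (h𝒩 : IsNest 𝒩) {X : H →L[ℂ] H} :
    X ∈ nestAlgebra 𝒩 ↔ ∀ N ∈ 𝒩, N * star X = N * star X * N := by
  refine forall₂_congr fun N hN => ?_
  have hp := h𝒩.isStarProjection N hN
  have : N * star X = N * star X * N ↔ X * N = N * X * N := by
    rw [← star_inj]
    simp only [star_mul, star_star, hp.isSelfAdjoint.star_eq, mul_assoc]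
  rw [this]
  constructor
  · intro h
    ext x
    obtain ⟨y, hy⟩ := h (N x) ⟨x, rfl⟩
    change X (N x) = N (X (N x))
    rw [← hy]
    exact (hp.apply_apply y).symm
  · rintro h _ ⟨x, rfl⟩
    exact ⟨X (N x), congr($h x).symm⟩

end NestInterpolation

theorem mainTheorem6 {H : Type*} [NormedAddCommGroup H] [InnerProductSpace ℂ H] [CompleteSpace H]
    (𝒩 : Set (H →L[ℂ] H)) (h𝒩 : IsNest 𝒩) (B C : H →L[ℂ] H) :
    (∃ X ∈ nestAlgebra 𝒩, ‖X‖ ≤ 1 ∧ B * X = C) ↔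
      ∀ N ∈ 𝒩, C * N * star C ≤ B * N * star B := by
  classical
  constructor
  · rintro ⟨X, hX, hX1, rfl⟩ N hN
    rw [mul_mul_star_le_iff N B (B * X) (h𝒩.isStarProjection N hN)]
    intro x
    have hNX := (mem_nestAlgebra_iff h𝒩).mp hX N hN
    have h1 : N (star (B * X) x) = N (star X (N (star B x))) := by
      rw [star_mul]
      exact congr($hNX (star B x))
    rw [h1]
    refine ((h𝒩.isStarProjection N hN).norm_apply_le _).trans ?_
    simpa using (star X).le_of_opNorm_le ((norm_star X).trans_le hX1) (N (star B x))
  · intro h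
    have hle : ∀ N ∈ 𝒩, ∀ x, ‖N (star C x)‖ ≤ ‖N (star B x)‖ := fun N hN =>
      (mul_mul_star_le_iff N B C (h𝒩.isStarProjection N hN)).mp (h N hN)
    have hfin : ∀ F : Finset 𝒩, ∃ Y : H →L[ℂ] H, ‖Y‖ ≤ 1 ∧ Y * star B = star C ∧
        ∀ M ∈ F, (M : H →L[ℂ] H) * Y = M * Y * M := by
      intro F
      obtain ⟨Y, h1, -, -, h4, h5⟩ := h𝒩.exists_contraction_finset hle
        (F.map (Function.Embedding.subtype _)) (by simp) 1 h𝒩.one_mem (by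
          intro M hM
          obtain ⟨L, -, rfl⟩ := Finset.mem_map.mp hM
          exact (h𝒩.isStarProjection L L.2).le_one)
      exact ⟨Y, h1, by simpa using h4,
        fun M hM => h5 M (Finset.mem_map_of_mem (Function.Embedding.subtype _) hM)⟩
    choose Y hY1 hYB hYN using hfin
    -- Refining `atTop` makes each single constraint hold eventually along `l`.
    let l : Ultrafilter (Finset 𝒩) := Ultrafilter.of Filter.atTop
    have hl : (l : Filter (Finset 𝒩)) ≤ Filter.atTop := Ultrafilter.of_le _
    obtain ⟨Z, hZ1, hZ⟩ := exists_tendsto_inner_of_norm_le_one l Y hY1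
    refine ⟨star Z, ?_, (norm_star Z).trans_le hZ1, ?_⟩
    · rw [mem_nestAlgebra_iff h𝒩]
      intro N hN
      have hp := h𝒩.isStarProjection N hN
      rw [star_star]
      ext x
      refine ext_inner_right ℂ fun y => ?_
      change inner ℂ (N (Z x)) y = inner ℂ (N (Z (N x))) y
      -- Moving `N` to the other side leaves only matrix coefficients of `Z`, which are weak limits.
      rw [hp.inner_apply_left, hp.inner_apply_left]
      refine tendsto_nhds_unique (hZ x (N y)) ((hZ (N x) (N y)).congr' ?_)
      filter_upwards [hl (Filter.eventually_ge_atTop {⟨N, hN⟩})] with F hF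
      rw [← hp.inner_apply_left, ← hp.inner_apply_left]
      have := hYN F ⟨N, hN⟩ (hF (Finset.mem_singleton_self _))
      exact congr(inner ℂ ($this x) y).symm
    · rw [← star_inj, star_mul, star_star]
      ext x
      refine ext_inner_right ℂ fun y => ?_
      refine tendsto_nhds_unique (hZ (star B x) y) (tendsto_const_nhds.congr fun F => ?_)
      exact congr(inner ℂ ($(hYB F) x) y).symm
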